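/- Let $\nu$ be a divisorial discrete valuation on $\mathbb{C}(x,y)$ centered at infinity. That is, $\nu$ is the order of vanishing along an irreducible curve $C$ on a normal surface $Y$ equipped with a birational morphism $\sigma: Y \to \mathbb{P}^2$, where $\mathbb{C}^2 \subset \mathbb{P}^2$ via $(x,y) \mapsto [1:x:y]$, and $\nu(f) < 0$ for some polynomial $f \in \mathbb{C}[x,y]$. For a valuation $\mu$ on $\mathbb{C}(x,y)$, a *generic degree-wise Puiseux series* of $\mu$ is a formal expression $\tilde\psi = \tilde\phi(x) + \xi x^{r}$, where $\xi$ is an indeterminate, $\tilde\phi$ is a finite sum of terms $a x^{q}$ with $a \in \mathbb{C}$, $q \in \mathbb{Q}$, and $r \in \mathbb{Q}$ is smaller than every exponent occurring in $\tilde\phi$, such that $$\mu(f(x,y)) = \mu(x)\,\deg_x\bigl(f(x, \tilde\phi(x) + \xi x^{r})\bigr) \quad \text{for every nonzero } f \in \mathbb{C}[x,y].$$ Then there is a finite composition $F$ of automorphisms of $\mathbb{C}[x,y]$ of the form $(x,y) \mapsto (y,x)$ or $(x,y) \mapsto (x, y + g(x))$ with $g \in \mathbb{C}[x]$, such that the valuation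 $\nu' := \nu \circ F$ (that is, $\nu$ written in the coordinates $(F(x), F(y))$) has a generic degree-wise Puiseux series, and every generic degree-wise Puiseux series $\tilde\psi$ of $\nu'$ has the following form: $$\tilde\psi = \begin{cases} \xi x^{r}, & r \in \mathbb{Q},\ r \le 1, \quad \text{or} \\ a_1 x^{\omega_1} + \text{(terms of lower order)}, & a_1 \in \mathbb{C}\setminus\{0\},\ \omega_1 \in \mathbb{Q} \setminus \left(\mathbb{Z}_{\ge 0} \cup \{1/n : n \in \mathbb{Z}_{\ge 1}\}\right),\ \omega_1 < 1, \end{cases}$$ where in the second case $a_1 x^{\omega_1}$ is the term of highest exponent of $\tilde\phi \neq 0$, and the term $\xi x^{r}$ is among the terms of lower order. -/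

import Mathlib

noncomputable section

namespace DegPuiseux

/-- The polynomial ring `ℂ[x, y]`; `X 0` is `x` and `X 1` is `y`. -/
abbrev Poly2 : Type := MvPolynomial (Fin 2) ℂ

/-- The field of rational functions `ℂ(x, y)`. -/
abbrev RatFun2 : Type := FractionRing Poly2

/-- A discrete valuation `ν : ℂ(x, y) ∖ {0} → ℤ`, extended by `ν 0 = ⊤`. (On a field, an additive
valuation takes the value `⊤` only at `0`.) -/
abbrev DiscVal : Type := AddValuation RatFun2 (WithTop ℤ)

/-- A polynomial, viewed as a rational function. -/
def toRat (f : Poly2) : RatFun2 := algebraMap Poly2 RatFun2 f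

/-- The coordinate function `x`. -/
def xK : RatFun2 := toRat (MvPolynomial.X 0)

/-- The coordinate function `y`. -/
def yK : RatFun2 := toRat (MvPolynomial.X 1)

/-- `R` is the coordinate ring of one of the three standard affine charts of the projective plane
`ℙ²`, where `ℂ²` is embedded in `ℙ²` by `(x, y) ↦ [1 : x : y]`. -/
def IsChartRing (R : Subalgebra ℂ RatFun2) : Prop :=
  R = Algebra.adjoin ℂ {xK, yK} ∨
  R = Algebra.adjoin ℂ {xK⁻¹, yK * xK⁻¹} ∨
  R = Algebra.adjoin ℂ {yK⁻¹, xK * yK⁻¹}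

/-- `ν` is divisorial: it is the order of vanishing along an irreducible curve `C` on a normal
surface `Y` with a birational morphism `σ : Y → ℙ²`. As the order of vanishing only depends on a
neighbourhood of a general point of `C`, the surface is represented by an affine open
subset `Spec A` which meets `C` and which `σ` maps into a standard chart `Spec R` of `ℙ²`:

* `A` is a finitely generated integrally closed `ℂ`-subalgebra of `ℂ(x, y)` that contains `R`
  (so `Frac A = ℂ(x, y)`, i.e. `σ` is birational);
* `p` is the prime ideal of `C`: it is nonzero and not maximal, so `C` is neither the whole
  surface nor a point;
* `ν` is the order of vanishing along `C`: for `f ∈ A` one has `ν f ≥ n` if and only if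
  `f ∈ pⁿ A_p`. -/
def IsDivisorial (ν : DiscVal) : Prop :=
  ∃ (R A : Subalgebra ℂ RatFun2) (p : Ideal A),
    IsChartRing R ∧ R ≤ A ∧ A.FG ∧ IsIntegrallyClosed A ∧
    p.IsPrime ∧ p ≠ ⊥ ∧ ¬ p.IsMaximal ∧
    ∀ (f : A) (n : ℕ), ((n : ℤ) : WithTop ℤ) ≤ ν (f : RatFun2) ↔ ∃ s : A, s ∉ p ∧ s * f ∈ p ^ n

/-- `ν` is centered at infinity: it is negative on some polynomial. -/
def IsCenteredAtInfinity (ν : DiscVal) : Prop :=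
  ∃ f : Poly2, ν (toRat f) < 0

/-- A formal expression `φ(x) + ξ x^r`, where `φ` is a degree-wise Puiseux polynomial, i.e. a finite
sum of terms `a x^q` with `a ∈ ℂ` and `q ∈ ℚ` (an element of the group algebra `ℂ[ℚ]`, in which
`single q a` stands for `a x^q`), and `r` is a rational number smaller than every exponent that
occurs in `φ`. -/
structure GenericSeries where
  /-- the Puiseux polynomial `φ` -/
  phi : AddMonoidAlgebra ℂ ℚ
  /-- the exponent of the generic term -/
  r : ℚ
  /-- `r < ord_x φ` -/
  r_lt : ∀ q ∈ phi.coeff.support, r < q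

/-- `φ(x) + ξ x^r`, as an element of `ℂ[ξ][x^q : q ∈ ℚ]`. -/
def GenericSeries.expr (ψ : GenericSeries) : AddMonoidAlgebra (Polynomial ℂ) ℚ :=
  AddMonoidAlgebra.mapRingHom ℚ (Polynomial.C : ℂ →+* Polynomial ℂ) ψ.phi +
    AddMonoidAlgebra.single ψ.r Polynomial.X

/-- `f(x, φ(x) + ξ x^r)`. -/
def GenericSeries.subst (ψ : GenericSeries) (f : Poly2) : AddMonoidAlgebra (Polynomial ℂ) ℚ :=
  MvPolynomial.aeval ![AddMonoidAlgebra.single (1 : ℚ) (1 : Polynomial ℂ), ψ.expr] f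

/-- `d = deg_x g`: the largest exponent of `x` which occurs in `g`. -/
def HasDegX (g : AddMonoidAlgebra (Polynomial ℂ) ℚ) (d : ℚ) : Prop :=
  IsGreatest (g.coeff.support : Set ℚ) d

/-- `ψ = φ(x) + ξ x^r` is a generic degree-wise Puiseux series of `ν`:
`ν(f) = ν(x) · deg_x f(x, φ(x) + ξ x^r)` for every nonzero polynomial `f`. -/
def IsGenericSeriesOf (ψ : GenericSeries) (ν : DiscVal) : Prop :=
  ∃ m : ℤ, ν xK = (m : WithTop ℤ) ∧
    ∀ f : Poly2, f ≠ 0 → ∃ (k : ℤ) (d : ℚ),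
      ν (toRat f) = (k : WithTop ℤ) ∧ HasDegX (ψ.subst f) d ∧ (k : ℚ) = (m : ℚ) * d

/-- The normal form: `ψ = ξ x^r` with `r ≤ 1`, or `ψ = a₁ x^ω + (lower order terms)` with `a₁ ≠ 0`,
where `ω < 1` is a rational number that is not a nonnegative integer and is not of the form `1/n`
with `n` a positive integer. -/
def GenericSeries.IsNormal (ψ : GenericSeries) : Prop :=
  (ψ.phi = 0 ∧ ψ.r ≤ 1) ∨
  ∃ ω : ℚ, IsGreatest (ψ.phi.coeff.support : Set ℚ) ω ∧ ω < 1 ∧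
    (∀ n : ℕ, ω ≠ n) ∧ (∀ n : ℕ, 1 ≤ n → ω ≠ 1 / (n : ℚ))

/-- The automorphism `(x, y) ↦ (y, x)` of `ℂ[x, y]`. -/
def IsTypeI (F : Poly2 ≃ₐ[ℂ] Poly2) : Prop :=
  F (MvPolynomial.X 0) = MvPolynomial.X 1 ∧ F (MvPolynomial.X 1) = MvPolynomial.X 0

/-- An automorphism `(x, y) ↦ (x, y + g(x))` of `ℂ[x, y]`, with `g` a polynomial in one variable. -/
def IsTypeII (F : Poly2 ≃ₐ[ℂ] Poly2) : Prop :=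
  ∃ g : Polynomial ℂ, F (MvPolynomial.X 0) = MvPolynomial.X 0 ∧
    F (MvPolynomial.X 1) =
      MvPolynomial.X 1 + Polynomial.aeval (MvPolynomial.X 0 : Poly2) g

/-- The valuation `ν` written in the coordinates `(F(x), F(y))`: it maps `h(x, y)` to
`ν(h(F(x), F(y)))`. -/
def inCoordinates (ν : DiscVal) (F : Poly2 ≃ₐ[ℂ] Poly2) : DiscVal :=
  ν.comap (IsFractionRing.ringEquivOfRingEquiv (K := RatFun2) (L := RatFun2)
    F.toRingEquiv : RatFun2 ≃+* RatFun2).toRingHom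

end DegPuiseux

end

/-! Existence. Let `ν x < 0`. In an extension field `E` with the same value group, `x⁻¹ = s ^ m` for
a uniformizer `s`: write `x⁻¹ = ε u ^ m` with `ε` a unit and adjoin an `m`-th root of `ε`, which is
unramified because `m` is invertible (`exists_valued_extension`). Expand `y` in powers of `s`,
removing terms `c s ^ i` with `c ∈ ℂ` as long as this lowers the error. If this never stopped, every
element of `ℂ[s, s⁻¹, y]` would be a limit of Laurent polynomials in `s`, and every unit that is a
quotient of two such elements would have its residue in `ℂ`. A divisorial valuation forbids this: a
curve has nonconstant functions. Hence `y = φ(s) + η s ^ i`, where the residue of `η` is not in `ℂ`,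
so it is transcendental, `ℂ` being algebraically closed (`exists_expansion`). Then `f(x, y)` is a
Laurent polynomial in `s` over `ℂ[η]`, on which the valuation is trivial, and its value is its
lowest exponent. Putting `s = x ^ (-1/m)` and `η = ξ` turns this into the degree in `x`
(`exists_isGenericSeriesOf`).

Normal form. Among all compositions of elementary automorphisms choose one minimizing a natural
number that drops when the value of a coordinate rises from a nonpositive value, with coordinates
ordered so that `ν x ≤ ν y`. Centering at infinity gives `ν x < 0`, so the leading exponent `ω = ν y
/ ν x` is at most `1`. If `ω = 0`, then `y - a` has positive value for the leading coefficient `a`;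
if `ω = 1/n`, then `x - a⁻ⁿ yⁿ` has larger value than `x` (`isNormal_or`). Either one contradicts
minimality, and `ω ≤ 1` excludes the integers above `1`. -/

namespace DegPuiseux

open IsLocalRing

/-! ### Making `x⁻¹` a power of a uniformizer in an unramified extension -/

/-- Adjoining a root of a polynomial `T ^ m - ε`, with `m` and `ε` invertible, is unramified. -/
theorem formallyUnramified_adjoin_root {O K : Type*} [CommRing O] [CommRing K] [Algebra O K]
    {m : ℕ} (hm0 : 0 < m) (hm : IsUnit (m : O)) (ε : Oˣ) {τ : K} (hτ : τ ^ m = algebraMap O K ε) :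
    Algebra.FormallyUnramified O (Algebra.adjoin O {τ}) := by
  rw [Algebra.formallyUnramified_iff]
  set B := Algebra.adjoin O {τ}
  let t : B := ⟨τ, Algebra.self_mem_adjoin_singleton O τ⟩
  have ht : t ^ m = algebraMap O B ε := Subtype.ext hτ
  have htu : IsUnit t := by
    rw [← isUnit_pow_iff hm0.ne', ht]
    exact ε.isUnit.map _
  -- Differentiating `t ^ m = ε` gives `m t ^ (m - 1) dt = 0`, and the factor before `dt` is a unit.
  have hDt : KaehlerDifferential.D O B t = 0 := by
    have h := congrArg (KaehlerDifferential.D O B) ht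
    rw [Derivation.map_algebraMap, Derivation.leibniz_pow, ← Nat.cast_smul_eq_nsmul B,
      smul_smul] at h
    have hu : IsUnit ((m : B) * t ^ (m - 1)) :=
      (by simpa using hm.map (algebraMap O B) : IsUnit (m : B)).mul (htu.pow _)
    exact hu.smul_eq_zero.1 h
  have hD : ∀ b : B, KaehlerDifferential.D O B b = 0 := by
    intro b
    obtain ⟨p, hp⟩ := (Algebra.adjoin_singleton_eq_range_aeval O τ).le b.2
    have hb : b = Polynomial.aeval t p := by
      apply Subtype.ext
      rw [← hp]
      exact (Polynomial.aeval_algHom_apply B.val t p)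
    rw [hb, Derivation.map_aeval, hDt, smul_zero]
  rw [← not_nontrivial_iff_subsingleton]
  intro hn
  have := KaehlerDifferential.span_range_derivation O B
  rw [Submodule.span_eq_bot.2 (by rintro _ ⟨b, rfl⟩; exact hD b)] at this
  exact bot_ne_top this

/-- Over a discrete valuation ring, one can extract an `m`-th root of a unit `ε`, where `m` is
invertible, in an extension of discrete valuation rings with the same uniformizer. -/
theorem exists_dvr_extension_root (O : Type) [CommRing O] [IsDomain O] [IsDiscreteValuationRing O]
    {m : ℕ} (hm0 : 0 < m) (hm : IsUnit (m : O)) (ε : Oˣ) {u : O} (hu : Irreducible u) :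
    ∃ (L : Type) (_ : CommRing L) (_ : IsDomain L) (_ : IsDiscreteValuationRing L) (_ : Algebra O L),
      Function.Injective (algebraMap O L) ∧ Irreducible (algebraMap O L u) ∧
        ∃ τ : L, τ ^ m = algebraMap O L ε := by
  let K := AlgebraicClosure (FractionRing O)
  have hinjK : Function.Injective (algebraMap O K) := by
    rw [IsScalarTower.algebraMap_eq O (FractionRing O) K]
    exact (algebraMap (FractionRing O) K).injective.comp (IsFractionRing.injective O _)
  obtain ⟨τ, hτ⟩ := IsAlgClosed.exists_pow_nat_eq (algebraMap O K ε) hm0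
  let B := Algebra.adjoin O {τ}
  have hunr : Algebra.FormallyUnramified O B := formallyUnramified_adjoin_root hm0 hm ε hτ
  have hint : IsIntegral O τ := by
    refine IsIntegral.of_pow hm0 ?_
    rw [hτ]
    exact isIntegral_algebraMap
  have hfin : Module.Finite O B := by
    exact Algebra.finite_adjoin_simple_of_isIntegral hint
  have hinjB : Function.Injective (algebraMap O B) := by
    intro a b hab
    exact hinjK (congrArg Subtype.val hab)
  -- `B` need not be local; localizing at any maximal ideal over that of `O` suffices.
  obtain ⟨P, hPm, hP⟩ := Ideal.exists_ideal_over_maximal_of_isIntegral (S := B) (maximalIdeal O)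
    (by rw [(RingHom.injective_iff_ker_eq_bot _).1 hinjB]; exact bot_le)
  have hPp : P.IsPrime := hPm.isPrime
  let L := Localization.AtPrime P
  have hinjL : Function.Injective (algebraMap B L) :=
    IsLocalization.injective L P.primeCompl_le_nonZeroDivisors
  have hmap : algebraMap O L = (algebraMap B L).comp (algebraMap O B) :=
    IsScalarTower.algebraMap_eq O B L
  have hinj : Function.Injective (algebraMap O L) := by
    rw [hmap]; exact hinjL.comp hinjB
  have hnoeB : IsNoetherianRing B := IsNoetherianRing.of_finite O B
  have hnoe : IsNoetherianRing L := IsLocalization.isNoetherianRing P.primeCompl L hnoeB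
  have hdom : IsDomain L := inferInstance
  have hloc : IsLocalHom (algebraMap O L) := by
    refine ((local_hom_TFAE (algebraMap O L)).out 0 4).2 ?_
    rw [hmap, ← Ideal.comap_comap]
    exact (congrArg _ (Localization.AtPrime.under_maximalIdeal (I := P))).trans hP
  have : Algebra.FormallyUnramified O L := Algebra.FormallyUnramified.comp O B L
  have : Algebra.EssFiniteType O L := Algebra.EssFiniteType.comp O B L
  -- Unramifiedness is used here: the maximal ideal of `O` generates that of `L`, so `u` remains a
  -- uniformizer.
  have hmax : maximalIdeal L = Ideal.span {algebraMap O L u} := by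
    rw [← Algebra.FormallyUnramified.map_maximalIdeal (R := O) (S := L), hu.maximalIdeal_eq,
      Ideal.map_span, Set.image_singleton]
  have hu0 : algebraMap O L u ≠ 0 := by
    rw [Ne, map_eq_zero_iff _ hinj]; exact hu.ne_zero
  have hnf : ¬ IsField L := by
    rw [isField_iff_maximalIdeal_eq, hmax, Ideal.span_singleton_eq_bot]
    exact hu0
  have htfae : IsDiscreteValuationRing L ↔ (maximalIdeal L).IsPrincipal :=
    (IsDiscreteValuationRing.TFAE L hnf).out 0 4
  have hdvr : IsDiscreteValuationRing L := htfae.2 ⟨⟨algebraMap O L u, hmax⟩⟩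
  refine ⟨L, inferInstance, hdom, hdvr, inferInstance, hinj, ?_, ?_⟩
  · exact (IsDiscreteValuationRing.irreducible_iff_uniformizer _).2 hmax
  · refine ⟨algebraMap B L ⟨τ, Algebra.self_mem_adjoin_singleton O τ⟩, ?_⟩
    rw [← map_pow, hmap, RingHom.comp_apply]
    exact congrArg _ (Subtype.ext hτ)

theorem exists_coe_eq_of_ne_zero {F : Type*} [Field F] (ν : AddValuation F (WithTop ℤ)) {f : F}
    (hf : f ≠ 0) : ∃ n : ℤ, ν f = (n : WithTop ℤ) := by
  obtain ⟨n, hn⟩ := WithTop.ne_top_iff_exists.1 ((AddValuation.ne_top_iff ν).2 hf)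
  exact ⟨n, hn.symm⟩

theorem addValuation_zpow {F : Type*} [Field F] (ν : AddValuation F (WithTop ℤ)) {u : F} {d : ℤ}
    (hu : ν u = (d : WithTop ℤ)) (k : ℤ) : ν (u ^ k) = ((d * k : ℤ) : WithTop ℤ) := by
  have hpow : ∀ n : ℕ, ν (u ^ n) = ((d * n : ℤ) : WithTop ℤ) := by
    intro n
    induction n with
    | zero => simp
    | succ n ih =>
      rw [pow_succ, AddValuation.map_mul, ih, hu, ← WithTop.coe_add]
      congr 1
      push_cast
      ring
  obtain ⟨n, rfl | rfl⟩ := k.eq_nat_or_neg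
  · rw [zpow_natCast, hpow]
  · rw [zpow_neg, zpow_natCast, AddValuation.map_inv, hpow,
      ← WithTop.LinearOrderedAddCommGroup.coe_neg, mul_neg]

/-- The valuation ring of a discrete valuation with value group `d ℤ` is a discrete valuation ring,
and the elements of value `d` are its uniformizers. -/
theorem isDiscreteValuationRing_valuationSubring {F : Type*} [Field F]
    (ν : AddValuation F (WithTop ℤ)) {u : F} {d : ℤ} (hd : 0 < d) (hu : ν u = (d : WithTop ℤ))
    (hdiv : ∀ f : F, f ≠ 0 → ∃ k : ℤ, ν f = ((d * k : ℤ) : WithTop ℤ)) :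
    IsDiscreteValuationRing (AddValuation.toValuation ν).valuationSubring ∧
      ∃ u' : (AddValuation.toValuation ν).valuationSubring, (u' : F) = u ∧ Irreducible u' := by
  set O := (AddValuation.toValuation ν).valuationSubring
  have hmem : ∀ f : F, f ∈ O ↔ 0 ≤ ν f := fun f => Iff.rfl
  have hunit : ∀ f : O, ν (f : F) = 0 → IsUnit f := by
    intro f hf
    have hf0 : (f : F) ≠ 0 := by
      rintro h
      rw [h, AddValuation.map_zero] at hf
      exact WithTop.top_ne_zero hf
    have hi : (f : F)⁻¹ ∈ O := by
      rw [hmem, AddValuation.map_inv, hf, neg_zero]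
    exact IsUnit.of_mul_eq_one (⟨_, hi⟩ : O) (Subtype.ext (mul_inv_cancel₀ hf0))
  have hu0 : u ≠ 0 := by
    rintro rfl
    rw [AddValuation.map_zero] at hu
    exact WithTop.top_ne_coe hu
  let u' : O := ⟨u, by rw [hmem, hu]; exact_mod_cast hd.le⟩
  have hnn : ∀ f : O, f ≠ 0 → ∃ k : ℕ, ν (f : F) = ((d * k : ℤ) : WithTop ℤ) := by
    intro f hf
    obtain ⟨k, hk⟩ := hdiv f (by simpa using hf)
    have h0 : 0 ≤ ν (f : F) := f.2
    rw [hk] at h0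
    have h1 : 0 ≤ d * k := by exact_mod_cast h0
    have h2 : 0 ≤ k := nonneg_of_mul_nonneg_right h1 hd
    obtain ⟨n, rfl⟩ := Int.eq_ofNat_of_zero_le h2
    exact ⟨n, hk⟩
  have hirr : Irreducible u' := by
    refine ⟨fun h => ?_, fun a b hab => ?_⟩
    · obtain ⟨w, hw⟩ := h.exists_right_inv
      have hw0 : w ≠ 0 := by
        rintro rfl
        simp at hw
      obtain ⟨k, hk⟩ := hnn w hw0
      have := congrArg (fun z : O => ν (z : F)) hw
      change ν (u * (w : F)) = ν 1 at this
      rw [AddValuation.map_mul, AddValuation.map_one, hu, hk, ← WithTop.coe_add] at this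
      have h3 : d + d * k = 0 := by exact_mod_cast this
      have : 0 ≤ d * (k : ℤ) := by positivity
      omega
    · have hab' : u = (a : F) * b := congrArg Subtype.val hab
      have ha0 : a ≠ 0 := by
        rintro rfl
        apply hu0
        simpa using hab'
      have hb0 : b ≠ 0 := by
        rintro rfl
        apply hu0
        simpa using hab'
      obtain ⟨i, hi⟩ := hnn a ha0
      obtain ⟨j, hj⟩ := hnn b hb0
      rw [hab', AddValuation.map_mul, hi, hj, ← WithTop.coe_add] at hu
      have h3 : d * (i + j : ℤ) = d * 1 := by
        rw [mul_add, mul_one]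
        exact_mod_cast hu
      have h4 := mul_left_cancel₀ hd.ne' h3
      rcases Nat.eq_zero_or_pos i with rfl | hi'
      · exact Or.inl (hunit a (by rw [hi]; simp))
      · obtain rfl : j = 0 := by omega
        exact Or.inr (hunit b (by rw [hj]; simp))
  refine ⟨IsDiscreteValuationRing.ofHasUnitMulPowIrreducibleFactorization ⟨u', hirr, ?_⟩,
    u', rfl, hirr⟩
  intro f hf
  obtain ⟨k, hk⟩ := hnn f hf
  refine ⟨k, ?_⟩
  have hq : ν ((f : F) * (u ^ (k : ℤ))⁻¹) = 0 := by
    rw [← zpow_neg, AddValuation.map_mul, hk, addValuation_zpow ν hu, ← WithTop.coe_add]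
    norm_cast
    ring
  have hqO : (f : F) * (u ^ (k : ℤ))⁻¹ ∈ O := by rw [hmem, hq]
  refine ⟨(hunit ⟨_, hqO⟩ hq).unit, Subtype.ext ?_⟩
  change u ^ k * ((f : F) * (u ^ (k : ℤ))⁻¹) = f
  rw [zpow_natCast]
  field_simp

/-- The values of a discrete valuation that is positive somewhere form a group `d ℤ`. -/
theorem exists_generator_values {F : Type*} [Field F] (ν : AddValuation F (WithTop ℤ))
    {X : F} (hX0 : X ≠ 0) (hX : 0 < ν X) :
    ∃ (u : F) (d : ℤ), 0 < d ∧ ν u = (d : WithTop ℤ) ∧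
      ∀ f : F, f ≠ 0 → ∃ k : ℤ, ν f = ((d * k : ℤ) : WithTop ℤ) := by
  classical
  -- The generator `d` is the least positive value; the remainder of any value modulo `d` is again a
  -- value, hence `0`.
  let P : ℕ → Prop := fun n => 0 < n ∧ ∃ u : F, ν u = ((n : ℤ) : WithTop ℤ)
  have hP : ∃ n, P n := by
    obtain ⟨n, hn⟩ := exists_coe_eq_of_ne_zero ν hX0
    rw [hn] at hX
    have h0 : 0 < n := by exact_mod_cast hX
    obtain ⟨k, rfl⟩ := Int.eq_ofNat_of_zero_le h0.le
    exact ⟨k, by exact_mod_cast h0, X, hn⟩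
  obtain ⟨hd, u, hu⟩ := Nat.find_spec hP
  set d := Nat.find hP with hd_def
  have hd' : (0 : ℤ) < d := by exact_mod_cast hd
  refine ⟨u, d, hd', hu, fun f hf => ?_⟩
  obtain ⟨n, hn⟩ := exists_coe_eq_of_ne_zero ν hf
  refine ⟨n / d, ?_⟩
  have hr : ν (f * u ^ (-(n / d))) = ((n % d : ℤ) : WithTop ℤ) := by
    rw [AddValuation.map_mul, hn, addValuation_zpow ν hu, ← WithTop.coe_add]
    congr 1
    rw [Int.emod_def]
    ring
  have h0 := Int.emod_nonneg n hd'.ne'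
  have h1 := Int.emod_lt_of_pos n hd'
  have h2 : n % d = 0 := by
    by_contra hne
    refine Nat.find_min hP (m := (n % d).toNat) (by omega) ⟨by omega, f * u ^ (-(n / d)), ?_⟩
    rw [hr, Int.toNat_of_nonneg h0]
  rw [hn, Int.mul_ediv_cancel' (Int.dvd_of_emod_eq_zero h2)]

/-- A discrete valuation `ν` on `F` with `ν X > 0` extends to a field in which `X` is a power of
a uniformizer. -/
theorem exists_valued_extension {F : Type} [Field F] (ν : AddValuation F (WithTop ℤ))
    (hν : ∀ n : ℕ, n ≠ 0 → ν n = 0) {X : F} (hX0 : X ≠ 0) (hX : 0 < ν X) :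
    ∃ (E : Type) (_ : Field E) (_ : Algebra F E) (v : Valuation E (WithZero (Multiplicative ℤ)))
      (s : E) (m : ℕ) (d : ℤ), 0 < m ∧ 0 < d ∧ v s = WithZero.exp (-1) ∧
        s ^ m = algebraMap F E X ∧
        ∀ f : F, f ≠ 0 → ∃ k : ℤ, ν f = ((d * k : ℤ) : WithTop ℤ) ∧
          v (algebraMap F E f) = WithZero.exp (-k) := by
  obtain ⟨u, d, hd, hu, hdiv⟩ := exists_generator_values ν hX0 hX
  obtain ⟨hdvr, u', hu', hirr⟩ := isDiscreteValuationRing_valuationSubring ν hd hu hdiv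
  set O := (AddValuation.toValuation ν).valuationSubring
  have hmem : ∀ f : F, f ∈ O ↔ 0 ≤ ν f := fun f => Iff.rfl
  have hu0 : u ≠ 0 := by
    rintro rfl
    rw [AddValuation.map_zero] at hu
    exact WithTop.top_ne_coe hu
  have hunit : ∀ f : F, ν f = 0 → ∃ w : Oˣ, ((w : O) : F) = f := by
    intro f hf
    have hf0 : f ≠ 0 := by
      rintro rfl
      rw [AddValuation.map_zero] at hf
      exact WithTop.top_ne_zero hf
    have hi : f⁻¹ ∈ O := by
      rw [hmem, AddValuation.map_inv, hf, neg_zero]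
    exact ⟨⟨⟨f, by rw [hmem, hf]⟩, ⟨f⁻¹, hi⟩, Subtype.ext (mul_inv_cancel₀ hf0),
      Subtype.ext (inv_mul_cancel₀ hf0)⟩, rfl⟩
  have hfact : ∀ f : F, ∀ k : ℤ, ν f = ((d * k : ℤ) : WithTop ℤ) →
      ∃ w : Oˣ, f = ((w : O) : F) * u ^ k := by
    intro f k hk
    obtain ⟨w, hw⟩ := hunit (f * u ^ (-k)) (by
      rw [AddValuation.map_mul, hk, addValuation_zpow ν hu, ← WithTop.coe_add]
      norm_cast
      ring)
    refine ⟨w, ?_⟩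
    rw [hw, zpow_neg, inv_mul_cancel_right₀ (zpow_ne_zero _ hu0)]
  obtain ⟨m', hm'⟩ := hdiv X hX0
  have hm'0 : 0 < m' := by
    rw [hm'] at hX
    have : 0 < d * m' := by exact_mod_cast hX
    exact (mul_pos_iff_of_pos_left hd).1 this
  obtain ⟨m, rfl⟩ := Int.eq_ofNat_of_zero_le hm'0.le
  have hm0 : 0 < m := by exact_mod_cast hm'0
  obtain ⟨ε, hε⟩ := hfact X m hm'
  have hmu : IsUnit (m : O) := by
    obtain ⟨w, hw⟩ := hunit (m : F) (hν m hm0.ne')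
    have : (w : O) = (m : O) := Subtype.ext (by rw [hw]; rfl)
    exact this ▸ w.isUnit
  obtain ⟨L, _, _, _, _, hinj, hirrL, τ, hτ⟩ := exists_dvr_extension_root O hm0 hmu ε hirr
  let E := FractionRing L
  have hinjE : Function.Injective (algebraMap O E) := by
    rw [IsScalarTower.algebraMap_eq O L E]
    exact (IsFractionRing.injective L E).comp hinj
  let ι : F →+* E := IsFractionRing.lift hinjE
  have hι : ∀ a : O, ι (a : F) = algebraMap L E (algebraMap O L a) := by
    intro a
    exact (IsFractionRing.lift_algebraMap hinjE a).trans (IsScalarTower.algebraMap_apply O L E a)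
  let v := (IsDiscreteValuationRing.maximalIdeal L).valuation E
  have hvu : v (ι u) = WithZero.exp (-1) := by
    rw [← hu', hι, IsDedekindDomain.HeightOneSpectrum.valuation_of_algebraMap]
    exact IsDedekindDomain.HeightOneSpectrum.intValuation_singleton _ hirrL.ne_zero
      hirrL.maximalIdeal_eq
  have hvle : ∀ a : O, v (ι (a : F)) ≤ 1 := by
    intro a
    rw [hι]
    exact IsDedekindDomain.HeightOneSpectrum.valuation_le_one _ _
  have hvunit : ∀ w : Oˣ, v (ι ((w : O) : F)) = 1 := by
    intro w
    refine le_antisymm (hvle _) ?_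
    have h1 : ι ((w : O) : F) * ι (((w⁻¹ : Oˣ) : O) : F) = 1 := by
      rw [← map_mul]
      have : ((w : O) : F) * (((w⁻¹ : Oˣ) : O) : F) = 1 := congrArg Subtype.val w.mul_inv
      rw [this, map_one]
    have h2 := congrArg v h1
    rw [map_mul, map_one] at h2
    rw [← h2]
    exact mul_le_of_le_one_right' (hvle _)
  have hvτ : v (algebraMap L E τ) = 1 := by
    have h : v (algebraMap L E τ) ^ m = 1 := by
      rw [← map_pow, ← map_pow, hτ, ← hι, hvunit]
    exact (pow_eq_one_iff_of_nonneg zero_le hm0.ne').1 h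
  -- Since `X = ε u ^ m` and `τ ^ m = ε`, the root is `s = τ u`; it is a uniformizer because `v τ =
  -- 1`.
  refine ⟨E, inferInstance, ι.toAlgebra, v, algebraMap L E τ * ι u, m, d, hm0, hd, ?_, ?_, ?_⟩
  · rw [map_mul, hvτ, one_mul, hvu]
  · change _ = ι X
    rw [mul_pow, ← map_pow, hτ, ← hι, hε, map_mul, ← map_pow, zpow_natCast]
  · intro f hf
    obtain ⟨k, hk⟩ := hdiv f hf
    refine ⟨k, hk, ?_⟩
    obtain ⟨w, hw⟩ := hfact f k hk
    change v (ι f) = _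
    rw [hw, map_mul, map_mul, hvunit, one_mul, map_zpow₀, map_zpow₀, hvu, ← WithZero.exp_zsmul]
    congr 1
    simp

end DegPuiseux

/-! ### Laurent polynomials in a uniformizer and the expansion of `y` -/

noncomputable section

namespace DegPuiseux

open WithZero

section LaurentEval

variable {R E : Type*} [CommRing R] [Field E]

/-- Evaluation of a Laurent polynomial with coefficients in `R` at a unit `s` of an `R`-algebra. -/
def laurentEval (α : R →+* E) (s : Eˣ) : AddMonoidAlgebra R ℤ →+* E :=
  AddMonoidAlgebra.liftNCRingHom α ((Units.coeHom E).comp (zpowersHom Eˣ s))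
    fun _ _ => Commute.all _ _

theorem laurentEval_single (α : R →+* E) (s : Eˣ) (j : ℤ) (r : R) :
    laurentEval α s (AddMonoidAlgebra.single j r) = α r * (s : E) ^ j := by
  rw [laurentEval, AddMonoidAlgebra.liftNCRingHom_single]
  simp

theorem laurentEval_eq_sum (α : R →+* E) (s : Eˣ) (G : AddMonoidAlgebra R ℤ) :
    laurentEval α s G = ∑ j ∈ G.coeff.support, α (G.coeff j) * (s : E) ^ j := by
  conv_lhs => rw [← AddMonoidAlgebra.sum_coeff_single G, Finsupp.sum, map_sum]
  simp only [laurentEval_single]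

variable (v : Valuation E (WithZero (Multiplicative ℤ)))

theorem valuation_zpow {s : E} (hs : v s = exp (-1)) (j : ℤ) : v (s ^ j) = exp (-j) := by
  rw [map_zpow₀, hs, ← exp_zsmul]
  congr 1
  simp

/-- Nonzero coefficients have valuation `1`, so distinct powers of `s` give terms of distinct
valuation and the lowest power dominates. -/
theorem valuation_laurentEval_sub_lt {α : R →+* E} {s : Eˣ} (hs : v (s : E) = exp (-1))
    (hα : ∀ r : R, r ≠ 0 → v (α r) = 1) {G : AddMonoidAlgebra R ℤ} {j : ℤ}
    (hj : IsLeast (G.coeff.support : Set ℤ) j) :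
    v (laurentEval α s G - α (G.coeff j) * (s : E) ^ j) < exp (-j) := by
  rw [laurentEval_eq_sum, ← Finset.add_sum_erase _ _ hj.1, add_sub_cancel_left]
  refine v.map_sum_lt exp_ne_zero fun i hi => ?_
  rw [map_mul, hα _ (Finsupp.mem_support_iff.1 (Finset.mem_of_mem_erase hi)), one_mul,
    valuation_zpow v hs, exp_lt_exp, neg_lt_neg_iff]
  exact lt_of_le_of_ne (hj.2 (Finset.mem_of_mem_erase hi)) (Finset.ne_of_mem_erase hi).symm

theorem valuation_laurentEval {α : R →+* E} {s : Eˣ} (hs : v (s : E) = exp (-1))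
    (hα : ∀ r : R, r ≠ 0 → v (α r) = 1) {G : AddMonoidAlgebra R ℤ} {j : ℤ}
    (hj : IsLeast (G.coeff.support : Set ℤ) j) :
    v (laurentEval α s G) = exp (-j) := by
  have h1 : v (α (G.coeff j) * (s : E) ^ j) = exp (-j) := by
    rw [map_mul, hα _ (Finsupp.mem_support_iff.1 hj.1), one_mul, valuation_zpow v hs]
  have h2 := valuation_laurentEval_sub_lt v hs hα hj
  rw [← h1] at h2 ⊢
  rw [← v.map_add_eq_of_lt_left h2, add_sub_cancel]

end LaurentEval

theorem exists_isLeast_support {R : Type*} [Semiring R] {G : AddMonoidAlgebra R ℤ} (hG : G ≠ 0) :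
    ∃ j, IsLeast (G.coeff.support : Set ℤ) j := by
  have h : G.coeff.support.Nonempty := by
    rw [Finsupp.support_nonempty_iff]
    contrapose! hG
    exact AddMonoidAlgebra.coeff_injective hG
  exact ⟨_, Finset.isLeast_min' _ h⟩

theorem exists_le_exp (x : WithZero (Multiplicative ℤ)) : ∃ N : ℤ, x ≤ exp N := by
  by_cases hx : x = 0
  · exact ⟨0, hx ▸ zero_le⟩
  · exact ⟨log x, (exp_log hx).ge⟩

theorem le_exp_of_lt_exp {x : WithZero (Multiplicative ℤ)} {i : ℤ} (h : x < exp (-i)) :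
    x ≤ exp (-(i + 1)) := by
  by_cases hx : x = 0
  · exact hx ▸ zero_le
  · rw [← exp_log hx, exp_lt_exp] at h
    rw [← exp_log hx, exp_le_exp]
    omega

section Expansion

variable {E : Type*} [Field E] [Algebra ℂ E] (v : Valuation E (WithZero (Multiplicative ℤ)))

/-- A valuation that is trivial on `ℂ` is trivial on `ℂ[η]` if the residue of `η` is transcendental
over `ℂ`. -/
theorem valuation_aeval_eq_one (hc : ∀ c : ℂ, c ≠ 0 → v (algebraMap ℂ E c) = 1) {η : E}
    (hη : ∀ c : ℂ, v (η - algebraMap ℂ E c) = 1) {p : Polynomial ℂ} (hp : p ≠ 0) :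
    v (Polynomial.aeval η p) = 1 := by
  rw [(IsAlgClosed.splits p).eq_prod_roots, map_mul, map_mul, Polynomial.aeval_C,
    hc _ (Polynomial.leadingCoeff_ne_zero.2 hp), one_mul, map_multiset_prod, map_multiset_prod,
    Multiset.map_map, Multiset.map_map]
  refine Multiset.prod_eq_one fun x hx => ?_
  obtain ⟨a, -, rfl⟩ := Multiset.mem_map.1 hx
  simpa using hη a

/-- The elements of `E` which can be approximated by Laurent polynomials in `s`. -/
def laurentClosure (s : Eˣ) : Subalgebra ℂ E where
  carrier := {z | ∀ i : ℤ, ∃ G, v (z - laurentEval (algebraMap ℂ E) s G) ≤ exp (-i)}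
  algebraMap_mem' c i := ⟨AddMonoidAlgebra.single 0 c, by rw [laurentEval_single]; simp⟩
  add_mem' {a b} ha hb i := by
    obtain ⟨G, hG⟩ := ha i
    obtain ⟨H, hH⟩ := hb i
    refine ⟨G + H, ?_⟩
    rw [map_add, add_sub_add_comm]
    exact v.map_add_le hG hH
  mul_mem' {a b} ha hb i := by
    obtain ⟨N, hN⟩ := exists_le_exp (v a)
    obtain ⟨H, hH⟩ := hb (i + N)
    -- `H` is fixed before `G`, since the precision required of `G` depends on the valuation of the
    -- value of `H`.
    obtain ⟨M, hM⟩ := exists_le_exp (v (laurentEval (algebraMap ℂ E) s H))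
    obtain ⟨G, hG⟩ := ha (i + M)
    refine ⟨G * H, ?_⟩
    rw [map_mul, show ∀ g h : E, a * b - g * h = a * (b - h) + (a - g) * h by intros; ring]
    refine v.map_add_le ?_ ?_
    · rw [map_mul]
      refine (mul_le_mul' hN hH).trans_eq ?_
      rw [← exp_add]
      congr 1
      ring
    · rw [map_mul]
      refine (mul_le_mul' hG hM).trans_eq ?_
      rw [← exp_add]
      congr 1
      ring

/-- An approximation finer than `v p` has the same valuation as `p`, and its lowest term also serves
as a leading term of `p`. -/
theorem exists_leading_term_of_mem_laurentClosure
    (hc : ∀ c : ℂ, c ≠ 0 → v (algebraMap ℂ E c) = 1) {s : Eˣ} (hs : v (s : E) = exp (-1)) {p : E}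
    (hp : p ∈ laurentClosure v s) (hp0 : p ≠ 0) :
    ∃ (k : ℤ) (c : ℂ), c ≠ 0 ∧ v p = exp (-k) ∧
      v (p - algebraMap ℂ E c * (s : E) ^ k) < exp (-k) := by
  have hvp : v p ≠ 0 := (Valuation.ne_zero_iff v).2 hp0
  obtain ⟨G, hG⟩ := hp (1 - log (v p))
  have hlt : v (p - laurentEval (algebraMap ℂ E) s G) < v p := by
    refine hG.trans_lt ?_
    conv_rhs => rw [← exp_log hvp]
    rw [exp_lt_exp]
    omega
  have hvG : v (laurentEval (algebraMap ℂ E) s G) = v p := by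
    rw [v.map_sub_swap] at hlt
    rw [← v.map_add_eq_of_lt_right hlt, sub_add_cancel]
  have hG0 : G ≠ 0 := by
    rintro rfl
    rw [map_zero, map_zero] at hvG
    exact hvp hvG.symm
  obtain ⟨j, hj⟩ := exists_isLeast_support hG0
  have h1 := valuation_laurentEval v hs hc hj
  have h2 := valuation_laurentEval_sub_lt v hs hc hj
  refine ⟨j, G.coeff j, Finsupp.mem_support_iff.1 hj.1, by rw [← hvG, h1], ?_⟩
  rw [← sub_add_sub_cancel p (laurentEval (algebraMap ℂ E) s G)]
  exact v.map_add_lt (by rwa [← h1, hvG]) h2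

/-- If the residue field of `v` on `ℂ(s, y)` is larger than `ℂ`, then `y = φ(s) + η s ^ i` where `φ`
is a Laurent polynomial of degree less than `i`, and the residue of `η` is not in `ℂ`. -/
theorem exists_expansion (hc : ∀ c : ℂ, c ≠ 0 → v (algebraMap ℂ E c) = 1) {s : Eˣ}
    (hs : v (s : E) = exp (-1)) {y p q : E} (hp : p ∈ Algebra.adjoin ℂ {(s : E), (s : E)⁻¹, y})
    (hq : q ∈ Algebra.adjoin ℂ {(s : E), (s : E)⁻¹, y}) (hq0 : q ≠ 0)
    (hpq : ∀ c : ℂ, v (p / q - algebraMap ℂ E c) = 1) :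
    ∃ (i : ℤ) (φ : AddMonoidAlgebra ℂ ℤ), (∀ j ∈ φ.coeff.support, j < i) ∧
      ∀ c : ℂ, v (y - laurentEval (algebraMap ℂ E) s φ - algebraMap ℂ E c * (s : E) ^ i) =
        exp (-i) := by
  classical
  by_contra! H
  have hc1 : ∀ c : ℂ, v (algebraMap ℂ E c) ≤ 1 := by
    intro c
    by_cases h : c = 0
    · simp [h]
    · exact (hc c h).le
  obtain ⟨N, hN⟩ := exists_le_exp (v y)
  -- The expansion starts at exponent `-N`, where `v y ≤ exp N`. At each step `H` supplies a
  -- coefficient `c` that makes the error strictly smaller, and by discreteness it gains a full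
  -- power of `s`.
  have happrox : ∀ n : ℕ, ∃ φ : AddMonoidAlgebra ℂ ℤ, (∀ j ∈ φ.coeff.support, j < -N + n) ∧
      v (y - laurentEval (algebraMap ℂ E) s φ) ≤ exp (-(-N + n)) := by
    intro n
    induction n with
    | zero => exact ⟨0, by simp, by simpa using hN⟩
    | succ n ih =>
      obtain ⟨φ, hφ, hv⟩ := ih
      obtain ⟨c, hcne⟩ := H _ φ hφ
      have hle : v (y - laurentEval (algebraMap ℂ E) s φ - algebraMap ℂ E c * (s : E) ^ (-N + n : ℤ))
          ≤ exp (-(-N + n)) := by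
        refine v.map_sub_le hv ?_
        rw [map_mul, valuation_zpow v hs]
        exact mul_le_of_le_one_left' (hc1 c)
      refine ⟨φ + AddMonoidAlgebra.single (-N + n) c, ?_, ?_⟩
      · intro j hj
        rw [AddMonoidAlgebra.coeff_add] at hj
        rcases Finset.mem_union.1 (Finsupp.support_add hj) with h | h
        · have := hφ j h
          push_cast
          omega
        · have := Finset.mem_singleton.1 (Finsupp.support_single_subset h)
          push_cast
          omega
      · rw [map_add, laurentEval_single, ← sub_sub]
        have := le_exp_of_lt_exp (lt_of_le_of_ne hle hcne)
        push_cast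
        rwa [← add_assoc]
  have hy : y ∈ laurentClosure v s := by
    intro i
    obtain ⟨φ, -, hφ⟩ := happrox (i + N).toNat
    refine ⟨φ, hφ.trans ?_⟩
    rw [exp_le_exp]
    omega
  have hle : Algebra.adjoin ℂ {(s : E), (s : E)⁻¹, y} ≤ laurentClosure v s := by
    refine Algebra.adjoin_le ?_
    rintro _ (rfl | rfl | rfl)
    · exact fun i => ⟨AddMonoidAlgebra.single 1 1, by rw [laurentEval_single]; simp⟩
    · exact fun i => ⟨AddMonoidAlgebra.single (-1) 1, by rw [laurentEval_single]; simp⟩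
    · exact hy
  have hz0 : v (p / q) = 1 := by simpa using hpq 0
  have hp0 : p ≠ 0 := by
    rintro rfl
    simp at hz0
  obtain ⟨k, c, -, hvp, hpk⟩ := exists_leading_term_of_mem_laurentClosure v hc hs (hle hp) hp0
  obtain ⟨l, d, hd, hvq, hql⟩ := exists_leading_term_of_mem_laurentClosure v hc hs (hle hq) hq0
  have hkl : k = l := by
    rw [map_div₀, hvp, hvq, div_eq_one_iff_eq exp_ne_zero, exp_inj] at hz0
    omega
  subst hkl
  have hd' : algebraMap ℂ E d ≠ 0 := by simpa using hd
  -- The quotient of the leading coefficients is the residue of `p / q`, contradicting `hpq (c /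
  -- d)`.
  have key : p / q - algebraMap ℂ E (c / d) =
      ((p - algebraMap ℂ E c * (s : E) ^ k) -
        algebraMap ℂ E (c / d) * (q - algebraMap ℂ E d * (s : E) ^ k)) / q := by
    rw [map_div₀]
    field_simp
    ring
  have hlt := hpq (c / d)
  rw [key, map_div₀, hvq, div_eq_one_iff_eq exp_ne_zero] at hlt
  refine absurd hlt (ne_of_lt (v.map_sub_lt hpk ?_))
  rw [map_mul]
  exact (mul_le_of_le_one_left' (hc1 _)).trans_lt hql

end Expansion

end DegPuiseux

end

/-! ### Existence of a generic degree-wise Puiseux series -/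

noncomputable section

namespace DegPuiseux

open WithZero

theorem laurentEval_mapRingHom {R S E : Type*} [CommRing R] [CommRing S] [Field E] (α : S →+* E)
    (β : R →+* S) (s : Eˣ) (G : AddMonoidAlgebra R ℤ) :
    laurentEval α s (AddMonoidAlgebra.mapRingHom ℤ β G) = laurentEval (α.comp β) s G := by
  rw [← RingHom.comp_apply]
  congr 1
  refine AddMonoidAlgebra.ringHom_ext (fun r => ?_) (fun j => ?_)
  · rw [RingHom.comp_apply, AddMonoidAlgebra.mapRingHom_single, laurentEval_single,
      laurentEval_single, RingHom.comp_apply]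
  · rw [RingHom.comp_apply, AddMonoidAlgebra.mapRingHom_single, laurentEval_single,
      laurentEval_single, RingHom.comp_apply]

/-- The map `j ↦ -j / m` from the exponents of `x ^ (-1 / m)` to those of `x`. -/
def degMap (m : ℕ) : ℤ →+ ℚ :=
  AddMonoidHom.mk' (fun j => -(j : ℚ) / m) fun a b => by push_cast; ring

theorem degMap_apply (m : ℕ) (j : ℤ) : degMap m j = -(j : ℚ) / m := rfl

theorem degMap_lt_degMap {m : ℕ} (hm : 0 < m) {i j : ℤ} : degMap m i < degMap m j ↔ j < i := by
  have : (0 : ℚ) < m := by exact_mod_cast hm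
  rw [degMap_apply, degMap_apply, div_lt_div_iff_of_pos_right this, neg_lt_neg_iff, Int.cast_lt]

theorem degMap_injective {m : ℕ} (hm : 0 < m) : Function.Injective (degMap m) := by
  intro i j h
  by_contra hne
  rcases lt_or_gt_of_ne hne with h' | h'
  · exact ((degMap_lt_degMap hm).2 h').ne' h
  · exact ((degMap_lt_degMap hm).2 h').ne h

theorem support_mapDomain_degMap {R : Type*} [Semiring R] {m : ℕ} (hm : 0 < m)
    (G : AddMonoidAlgebra R ℤ) :
    ((AddMonoidAlgebra.mapDomain (degMap m) G).coeff.support : Set ℚ) =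
      degMap m '' (G.coeff.support : Set ℤ) := by
  classical
  rw [AddMonoidAlgebra.coeff_mapDomain, Finsupp.mapDomain_support_of_injective (degMap_injective hm)]
  simp

/-- `degMap m` reverses the order, so the lowest power of `s` becomes the highest power of `x`. -/
theorem hasDegX_mapDomain_degMap {m : ℕ} (hm : 0 < m) {G : AddMonoidAlgebra (Polynomial ℂ) ℤ}
    {j : ℤ} (hj : IsLeast (G.coeff.support : Set ℤ) j) :
    HasDegX (AddMonoidAlgebra.mapDomain (degMap m) G) (degMap m j) := by
  rw [HasDegX, support_mapDomain_degMap hm]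
  refine ⟨⟨j, hj.1, rfl⟩, ?_⟩
  rintro _ ⟨i, hi, rfl⟩
  by_contra! h
  exact absurd (hj.2 hi) (not_le.2 ((degMap_lt_degMap hm).1 h))

/-- The generic series obtained from a Laurent polynomial `φ + ξ s ^ i` by `s = x ^ (-1 / m)`. -/
def GenericSeries.ofLaurent {m : ℕ} (hm : 0 < m) (φ : AddMonoidAlgebra ℂ ℤ) (i : ℤ)
    (hφ : ∀ j ∈ φ.coeff.support, j < i) : GenericSeries where
  phi := AddMonoidAlgebra.mapDomain (degMap m) φ
  r := degMap m i
  r_lt q hq := by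
    have hq' : q ∈ degMap m '' (φ.coeff.support : Set ℤ) := by
      rw [← support_mapDomain_degMap hm]
      exact hq
    obtain ⟨j, hj, rfl⟩ := hq'
    exact (degMap_lt_degMap hm).2 (hφ j hj)

/-- The substitution `f ↦ f(s ^ (-m), φ + ξ s ^ i)`. -/
def laurentSubst (m : ℕ) (φ : AddMonoidAlgebra ℂ ℤ) (i : ℤ) :
    Poly2 →ₐ[ℂ] AddMonoidAlgebra (Polynomial ℂ) ℤ :=
  MvPolynomial.aeval ![AddMonoidAlgebra.single (-m : ℤ) (1 : Polynomial ℂ),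
    AddMonoidAlgebra.mapRingHom ℤ (Polynomial.C : ℂ →+* Polynomial ℂ) φ +
      AddMonoidAlgebra.single i Polynomial.X]

theorem GenericSeries.subst_ofLaurent {m : ℕ} (hm : 0 < m) (φ : AddMonoidAlgebra ℂ ℤ) (i : ℤ)
    (hφ : ∀ j ∈ φ.coeff.support, j < i) (f : Poly2) :
    (GenericSeries.ofLaurent hm φ i hφ).subst f =
      AddMonoidAlgebra.mapDomain (degMap m) (laurentSubst m φ i f) := by
  have hm' : (m : ℚ) ≠ 0 := by exact_mod_cast hm.ne'
  have h : AddMonoidAlgebra.mapRingHom ℚ (Polynomial.C : ℂ →+* Polynomial ℂ)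
      (AddMonoidAlgebra.mapDomain (degMap m) φ) =
      AddMonoidAlgebra.mapDomain (degMap m)
        (AddMonoidAlgebra.mapRingHom ℤ (Polynomial.C : ℂ →+* Polynomial ℂ) φ) := by
    exact DFunLike.congr_fun
      (AddMonoidAlgebra.mapRingHom_comp_mapDomainRingHom (Polynomial.C : ℂ →+* Polynomial ℂ)
        (degMap m)) φ
  change _ = AddMonoidAlgebra.mapDomainAlgHom ℂ (Polynomial ℂ) (degMap m) _
  rw [laurentSubst, MvPolynomial.comp_aeval_apply, GenericSeries.subst]
  congr 2
  funext k
  fin_cases k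
  · change AddMonoidAlgebra.single 1 1 =
      AddMonoidAlgebra.mapDomain (degMap m) (AddMonoidAlgebra.single (-m : ℤ) 1)
    rw [AddMonoidAlgebra.mapDomain_single, degMap_apply]
    congr 1
    push_cast
    field_simp
  · change AddMonoidAlgebra.mapRingHom ℚ Polynomial.C (AddMonoidAlgebra.mapDomain (degMap m) φ) +
        AddMonoidAlgebra.single (degMap m i) Polynomial.X =
      AddMonoidAlgebra.mapDomain (degMap m)
        (AddMonoidAlgebra.mapRingHom ℤ Polynomial.C φ + AddMonoidAlgebra.single i Polynomial.X)
    rw [h, AddMonoidAlgebra.mapDomain_add, AddMonoidAlgebra.mapDomain_single]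

/-- A discrete valuation on `ℂ(x, y)` that is negative on `x`, trivial on `ℂ`, and whose residue
field is not `ℂ`, has a generic degree-wise Puiseux series. -/
theorem exists_isGenericSeriesOf (ν : DiscVal)
    (hν : ∀ c : ℂ, c ≠ 0 → ν (algebraMap ℂ RatFun2 c) = 0) {z : RatFun2}
    (hz : ∀ c : ℂ, ν (z - algebraMap ℂ RatFun2 c) = 0) (hx : ν xK < 0) :
    ∃ ψ : GenericSeries, IsGenericSeriesOf ψ ν := by
  have hx0 : xK ≠ 0 := by
    intro h
    rw [h, AddValuation.map_zero] at hx
    exact not_top_lt hx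
  obtain ⟨a, ha⟩ := exists_coe_eq_of_ne_zero ν hx0
  have hX : 0 < ν xK⁻¹ := by
    rw [AddValuation.map_inv, ha, ← WithTop.LinearOrderedAddCommGroup.coe_neg]
    rw [ha] at hx
    have : a < 0 := by exact_mod_cast hx
    exact_mod_cast neg_pos.2 this
  have hnat : ∀ n : ℕ, n ≠ 0 → ν (n : RatFun2) = 0 := by
    intro n hn
    simpa using hν n (by exact_mod_cast hn)
  obtain ⟨E, _, _, v, s₀, m, d, hm, hd, hs, hsm, hval⟩ :=
    exists_valued_extension ν hnat (inv_ne_zero hx0) hX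
  set ι := algebraMap RatFun2 E
  let _ : Algebra ℂ E := (ι.comp (algebraMap ℂ RatFun2)).toAlgebra
  have hιc : ∀ c : ℂ, algebraMap ℂ E c = ι (algebraMap ℂ RatFun2 c) := fun c => rfl
  have hv1 : ∀ f : RatFun2, ν f = 0 → v (ι f) = 1 := by
    intro f hf
    have hf0 : f ≠ 0 := by
      rintro rfl
      rw [AddValuation.map_zero] at hf
      exact WithTop.top_ne_zero hf
    obtain ⟨k, hk, hvk⟩ := hval f hf0
    rw [hf] at hk
    have h0 : d * k = 0 := by exact_mod_cast hk.symm
    have hk0 : k = 0 := by simpa [hd.ne'] using h0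
    rw [hvk, hk0, neg_zero, exp_zero]
  have hs0 : s₀ ≠ 0 := by
    rintro rfl
    rw [map_zero] at hs
    exact exp_ne_zero hs.symm
  obtain ⟨s, rfl⟩ : ∃ s : Eˣ, (s : E) = s₀ := ⟨Units.mk0 s₀ hs0, rfl⟩
  have hxs : ι xK = (s : E) ^ (-m : ℤ) := by
    rw [zpow_neg, zpow_natCast, hsm, map_inv₀, inv_inv]
  have hc : ∀ c : ℂ, c ≠ 0 → v (algebraMap ℂ E c) = 1 := fun c h => hv1 _ (hν c h)
  have hpoly : ∀ f : Poly2, ι (toRat f) ∈ Algebra.adjoin ℂ {(s : E), (s : E)⁻¹, ι yK} := by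
    intro f
    induction f using MvPolynomial.induction_on with
    | C c =>
      have : ι (toRat (MvPolynomial.C c)) = algebraMap ℂ E c := rfl
      rw [this]
      exact Subalgebra.algebraMap_mem _ c
    | add p q hp hq =>
      rw [toRat, map_add, map_add]
      exact add_mem hp hq
    | mul_X p k hp =>
      rw [toRat, map_mul, map_mul]
      refine mul_mem hp ?_
      fin_cases k
      · change ι xK ∈ _
        rw [hxs, zpow_neg, zpow_natCast, ← inv_pow]
        exact pow_mem (Algebra.subset_adjoin (by simp)) m
      · exact Algebra.subset_adjoin (by simp [yK, toRat])
  obtain ⟨p, q, hq, hpq⟩ := IsFractionRing.div_surjective (A := Poly2) z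
  have hq0 : ι (toRat q) ≠ 0 := by
    rw [Ne, map_eq_zero]
    exact IsFractionRing.to_map_ne_zero_of_mem_nonZeroDivisors hq
  obtain ⟨i, φ, hφ, hi⟩ := exists_expansion v hc hs (y := ι yK) (hpoly p) (hpoly q) hq0 (by
    intro c
    rw [← map_div₀]
    change v (ι (algebraMap _ _ p / algebraMap _ _ q) - ι (algebraMap ℂ RatFun2 c)) = 1
    rw [hpq, ← map_sub]
    exact hv1 _ (hz c))
  have hsi : (s : E) ^ i ≠ 0 := zpow_ne_zero _ s.ne_zero
  set η : E := (ι yK - laurentEval (algebraMap ℂ E) s φ) / (s : E) ^ i with hη_def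
  have hη : ∀ c : ℂ, v (η - algebraMap ℂ E c) = 1 := by
    intro c
    have : η - algebraMap ℂ E c =
        (ι yK - laurentEval (algebraMap ℂ E) s φ - algebraMap ℂ E c * (s : E) ^ i) /
          (s : E) ^ i := by
      rw [hη_def]
      field_simp
    rw [this, map_div₀, hi, valuation_zpow v hs, div_self exp_ne_zero]
  -- `Θ` specializes `ξ` to `η`; after `laurentSubst` it recovers the true value of `f(x, y)` in
  -- `E`.
  set Θ := laurentEval (Polynomial.aeval η : Polynomial ℂ →ₐ[ℂ] E).toRingHom s
  have hΘ : ∀ f : Poly2, Θ (laurentSubst m φ i f) = ι (toRat f) := by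
    have : Θ.comp (laurentSubst m φ i).toRingHom = ι.comp (algebraMap Poly2 RatFun2) := by
      refine MvPolynomial.ringHom_ext (fun c => ?_) (fun k => ?_)
      · change Θ (laurentSubst m φ i (algebraMap ℂ Poly2 c)) = algebraMap ℂ E c
        rw [AlgHom.commutes]
        change Θ (AddMonoidAlgebra.single 0 (Polynomial.C c)) = _
        rw [laurentEval_single]
        simp
      · change Θ (laurentSubst m φ i (MvPolynomial.X k)) = _
        rw [laurentSubst, MvPolynomial.aeval_X]
        fin_cases k
        · change Θ (AddMonoidAlgebra.single (-m : ℤ) (1 : Polynomial ℂ)) = ι xK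
          rw [laurentEval_single, map_one, one_mul, hxs]
        · change Θ (AddMonoidAlgebra.mapRingHom ℤ (Polynomial.C : ℂ →+* Polynomial ℂ) φ +
            AddMonoidAlgebra.single i Polynomial.X) = ι yK
          rw [map_add, laurentEval_mapRingHom, laurentEval_single]
          have h1 : (Polynomial.aeval η : Polynomial ℂ →ₐ[ℂ] E).toRingHom.comp Polynomial.C =
              algebraMap ℂ E := by
            ext c
            simp
          have h2 : (Polynomial.aeval η : Polynomial ℂ →ₐ[ℂ] E).toRingHom Polynomial.X = η := by
            simp
          rw [h1, h2, hη_def, div_mul_cancel₀ _ hsi, add_sub_cancel]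
    exact fun f => DFunLike.congr_fun this f
  have hinj : ∀ f : Poly2, f ≠ 0 → toRat f ≠ 0 := by
    intro f hf
    rwa [toRat, Ne, map_eq_zero_iff _ (IsFractionRing.injective Poly2 RatFun2)]
  have hmain : ∀ f : Poly2, f ≠ 0 → ∃ j : ℤ,
      ν (toRat f) = ((d * j : ℤ) : WithTop ℤ) ∧
        HasDegX ((GenericSeries.ofLaurent hm φ i hφ).subst f) (degMap m j) := by
    intro f hf
    have hG0 : laurentSubst m φ i f ≠ 0 := by
      intro h
      have := hΘ f
      rw [h, map_zero] at this
      exact hinj f hf ((map_eq_zero ι).1 this.symm)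
    obtain ⟨j, hj⟩ := exists_isLeast_support hG0
    -- No cancellation is possible: every nonzero element of `ℂ[ξ]` specializes to an element of
    -- valuation `1`.
    have hvj := valuation_laurentEval v (s := s) hs
      (α := (Polynomial.aeval η : Polynomial ℂ →ₐ[ℂ] E).toRingHom)
      (fun p hp => valuation_aeval_eq_one v hc hη hp) hj
    change v (Θ _) = _ at hvj
    obtain ⟨k, hk, hvk⟩ := hval _ (hinj f hf)
    rw [hΘ, hvk, exp_inj, neg_inj] at hvj
    subst hvj
    refine ⟨k, hk, ?_⟩
    rw [GenericSeries.subst_ofLaurent]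
    exact hasDegX_mapDomain_degMap hm hj
  have hm' : (m : ℚ) ≠ 0 := by exact_mod_cast hm.ne'
  have hνx : ν xK = ((d * (-m) : ℤ) : WithTop ℤ) := by
    obtain ⟨k, hk, hvk⟩ := hval _ hx0
    change v (ι xK) = _ at hvk
    rw [hxs, valuation_zpow v hs, exp_inj, neg_inj] at hvk
    rw [hk, hvk]
  refine ⟨GenericSeries.ofLaurent hm φ i hφ, _, hνx, fun f hf => ?_⟩
  obtain ⟨j, hj, hdeg⟩ := hmain f hf
  refine ⟨_, _, hj, hdeg, ?_⟩
  rw [degMap_apply]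
  push_cast
  field_simp

end DegPuiseux

end

/-! ### Divisorial valuations and changes of coordinates -/

noncomputable section

namespace DegPuiseux

open MvPolynomial (X C)

/-- A divisorial valuation is trivial on `ℂ`, and its residue field is larger than `ℂ`. -/
theorem IsDivisorial.residue {ν : DiscVal} (h : IsDivisorial ν) :
    (∀ c : ℂ, c ≠ 0 → ν (algebraMap ℂ RatFun2 c) = 0) ∧
      ∃ z : RatFun2, ∀ c : ℂ, ν (z - algebraMap ℂ RatFun2 c) = 0 := by
  obtain ⟨R, A, p, -, -, -, -, hp, -, hpm, hν⟩ := h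
  have hnn : ∀ a : A, 0 ≤ ν (a : RatFun2) := by
    intro a
    have := (hν a 0).2 ⟨1, fun h1 => hp.ne_top ((Ideal.eq_top_iff_one p).2 h1), by simp⟩
    simpa using this
  have hc : ∀ c : ℂ, c ≠ 0 → ν (algebraMap ℂ RatFun2 c) = 0 := by
    intro c hc
    have h1 : 0 ≤ ν (algebraMap ℂ RatFun2 c) := hnn (algebraMap ℂ A c)
    have h2 : 0 ≤ ν (algebraMap ℂ RatFun2 c⁻¹) := hnn (algebraMap ℂ A c⁻¹)
    have hc0 : algebraMap ℂ RatFun2 c ≠ 0 := by simpa using hc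
    obtain ⟨n, hn⟩ := exists_coe_eq_of_ne_zero ν hc0
    rw [map_inv₀, AddValuation.map_inv, hn, ← WithTop.LinearOrderedAddCommGroup.coe_neg] at h2
    rw [hn] at h1 ⊢
    have h1' : 0 ≤ n := by exact_mod_cast h1
    have h2' : 0 ≤ -n := by exact_mod_cast h2
    have : n = 0 := by omega
    rw [this]
    rfl
  refine ⟨hc, ?_⟩
  by_contra! H
  -- Otherwise each `x ∈ A` has some `c` with `ν (x - c) > 0`, that is `x - c ∈ p`; so `A / p = ℂ`
  -- and `p` would be maximal.
  refine hpm (Ideal.isMaximal_iff.2 ⟨fun h1 => hp.ne_top ((Ideal.eq_top_iff_one p).2 h1), ?_⟩)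
  intro J x hJ hx hxJ
  obtain ⟨c, hcx⟩ := H x
  have h1 : (((1 : ℕ) : ℤ) : WithTop ℤ) ≤ ν ((x - algebraMap ℂ A c : A) : RatFun2) := by
    have h0 := hnn (x - algebraMap ℂ A c)
    change ν ((x - algebraMap ℂ A c : A) : RatFun2) ≠ 0 at hcx
    generalize ν ((x - algebraMap ℂ A c : A) : RatFun2) = n at *
    induction n using WithTop.recTopCoe with
    | top => exact le_top
    | coe n =>
      have h0' : 0 ≤ n := by exact_mod_cast h0
      have hne : n ≠ 0 := by exact_mod_cast hcx
      have : ((1 : ℕ) : ℤ) ≤ n := by omega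
      exact_mod_cast this
  obtain ⟨s, hs, hsp⟩ := (hν _ 1).1 h1
  rw [pow_one] at hsp
  have hxc : x - algebraMap ℂ A c ∈ p := (hp.mem_or_mem hsp).resolve_left hs
  have hc0 : c ≠ 0 := by
    rintro rfl
    apply hx
    simpa using hxc
  have hcJ : algebraMap ℂ A c ∈ J := by
    have := J.sub_mem hxJ (hJ hxc)
    simpa using this
  have := J.mul_mem_left (algebraMap ℂ A c⁻¹) hcJ
  rwa [← map_mul, inv_mul_cancel₀ hc0, map_one] at this

section Coordinates

variable (ν : DiscVal) (F : Poly2 ≃ₐ[ℂ] Poly2)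

theorem inCoordinates_toRat (f : Poly2) : inCoordinates ν F (toRat f) = ν (toRat (F f)) := by
  change ν (IsFractionRing.ringEquivOfRingEquiv (K := RatFun2) (L := RatFun2)
    F.toRingEquiv (algebraMap Poly2 RatFun2 f)) = _
  rw [IsFractionRing.ringEquivOfRingEquiv_algebraMap]
  rfl

theorem inCoordinates_algebraMap (c : ℂ) :
    inCoordinates ν F (algebraMap ℂ RatFun2 c) = ν (algebraMap ℂ RatFun2 c) := by
  have := inCoordinates_toRat ν F (algebraMap ℂ Poly2 c)
  rwa [AlgEquiv.commutes] at this

theorem inCoordinates_residue {z : RatFun2} (hz : ∀ c : ℂ, ν (z - algebraMap ℂ RatFun2 c) = 0) :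
    ∃ z' : RatFun2, ∀ c : ℂ, inCoordinates ν F (z' - algebraMap ℂ RatFun2 c) = 0 := by
  set e := IsFractionRing.ringEquivOfRingEquiv (K := RatFun2) (L := RatFun2) F.toRingEquiv
  refine ⟨e.symm z, fun c => ?_⟩
  have hec : e (algebraMap ℂ RatFun2 c) = algebraMap ℂ RatFun2 c := by
    change e (algebraMap Poly2 RatFun2 (algebraMap ℂ Poly2 c)) =
      algebraMap Poly2 RatFun2 (algebraMap ℂ Poly2 c)
    rw [IsFractionRing.ringEquivOfRingEquiv_algebraMap]
    exact congrArg _ (F.commutes c)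
  change ν (e (e.symm z - algebraMap ℂ RatFun2 c)) = 0
  rw [map_sub, e.apply_symm_apply, hec, hz]

theorem inCoordinates_centered (h : IsCenteredAtInfinity ν) :
    IsCenteredAtInfinity (inCoordinates ν F) := by
  obtain ⟨f, hf⟩ := h
  exact ⟨F.symm f, by rwa [inCoordinates_toRat, F.apply_symm_apply]⟩

end Coordinates

/-- If `x`, and hence `y`, had nonnegative value, so would every polynomial. -/
theorem IsCenteredAtInfinity.lt_zero {ν : DiscVal} (h : IsCenteredAtInfinity ν)
    (hν : ∀ c : ℂ, c ≠ 0 → ν (algebraMap ℂ RatFun2 c) = 0) (hxy : ν xK ≤ ν yK) : ν xK < 0 := by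
  by_contra! hx
  obtain ⟨f, hf⟩ := h
  refine absurd hf (not_lt.2 ?_)
  clear hf
  induction f using MvPolynomial.induction_on with
  | C c =>
    by_cases hc : c = 0
    · simp [hc, toRat]
    · exact (hν c hc).ge
  | add p q hp hq =>
    rw [toRat, map_add]
    exact ν.map_le_add hp hq
  | mul_X p k hp =>
    rw [toRat, map_mul, AddValuation.map_mul]
    refine add_nonneg hp ?_
    fin_cases k
    · exact hx
    · exact hx.trans hxy

section Automorphisms

/-- The automorphism `(x, y) ↦ (y, x)`. -/
def swapAut : Poly2 ≃ₐ[ℂ] Poly2 := MvPolynomial.renameEquiv ℂ (Equiv.swap 0 1)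

theorem swapAut_X_zero : swapAut (X 0) = X 1 := by simp [swapAut]

theorem swapAut_X_one : swapAut (X 1) = X 0 := by simp [swapAut]

theorem isTypeI_swapAut : IsTypeI swapAut := ⟨swapAut_X_zero, swapAut_X_one⟩

/-- The endomorphism `(x, y) ↦ (x, y + g(x))`. -/
def shearHom (g : Polynomial ℂ) : Poly2 →ₐ[ℂ] Poly2 :=
  MvPolynomial.aeval ![X 0, X 1 + Polynomial.aeval (X 0 : Poly2) g]

theorem shearHom_X_zero (g : Polynomial ℂ) : shearHom g (X 0) = X 0 := by simp [shearHom]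

theorem shearHom_X_one (g : Polynomial ℂ) :
    shearHom g (X 1) = X 1 + Polynomial.aeval (X 0 : Poly2) g := by simp [shearHom]

theorem shearHom_aeval (g p : Polynomial ℂ) :
    shearHom g (Polynomial.aeval (X 0 : Poly2) p) = Polynomial.aeval (X 0 : Poly2) p := by
  rw [← Polynomial.aeval_algHom_apply, shearHom_X_zero]

theorem shearHom_comp_neg (g : Polynomial ℂ) :
    (shearHom g).comp (shearHom (-g)) = AlgHom.id ℂ Poly2 := by
  refine MvPolynomial.algHom_ext fun k => ?_
  fin_cases k
  · change shearHom g (shearHom (-g) (X 0)) = X 0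
    rw [shearHom_X_zero, shearHom_X_zero]
  · change shearHom g (shearHom (-g) (X 1)) = X 1
    rw [shearHom_X_one, map_add, shearHom_X_one, shearHom_aeval, map_neg, add_neg_cancel_right]

/-- The automorphism `(x, y) ↦ (x, y + g(x))`. -/
def shearAut (g : Polynomial ℂ) : Poly2 ≃ₐ[ℂ] Poly2 :=
  AlgEquiv.ofAlgHom (shearHom g) (shearHom (-g)) (shearHom_comp_neg g) (by
    simpa using shearHom_comp_neg (-g))

theorem shearAut_X_zero (g : Polynomial ℂ) : shearAut g (X 0) = X 0 := shearHom_X_zero g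

theorem shearAut_X_one (g : Polynomial ℂ) :
    shearAut g (X 1) = X 1 + Polynomial.aeval (X 0 : Poly2) g := shearHom_X_one g

theorem isTypeII_shearAut (g : Polynomial ℂ) : IsTypeII (shearAut g) :=
  ⟨g, shearAut_X_zero g, shearAut_X_one g⟩

end Automorphisms

end DegPuiseux

end

/-! ### Leading terms of generic series and the obstructions to normal form -/

noncomputable section

namespace DegPuiseux

open MvPolynomial (X C)

section Degree

variable {R : Type*} [CommRing R] {g h : AddMonoidAlgebra R ℚ} {p q : ℚ}

/-- The elements of `R[x^q : q ∈ ℚ]` of degree less than `p`. -/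
def degLT (R : Type*) [CommRing R] (p : ℚ) : AddSubgroup (AddMonoidAlgebra R ℚ) where
  carrier := {g | ∀ q ∈ g.coeff.support, q < p}
  zero_mem' := by simp
  add_mem' {a b} ha hb q hq := by
    classical
    rw [AddMonoidAlgebra.coeff_add] at hq
    exact (Finset.mem_union.1 (Finsupp.support_add hq)).elim (ha q) (hb q)
  neg_mem' {a} ha q hq := by
    rw [AddMonoidAlgebra.coeff_neg, Finsupp.support_neg] at hq
    exact ha q hq

theorem single_mem_degLT (hqp : q < p) (r : R) : AddMonoidAlgebra.single q r ∈ degLT R p := by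
  intro i hi
  rw [Finset.mem_singleton.1 (Finsupp.support_single_subset hi)]
  exact hqp

theorem mul_mem_degLT (hg : g ∈ degLT R p) (hh : h ∈ degLT R q) : g * h ∈ degLT R (p + q) := by
  classical
  intro i hi
  obtain ⟨a, ha, b, hb, rfl⟩ := Finset.mem_add.1 (AddMonoidAlgebra.support_coeff_mul_subset g h hi)
  exact add_lt_add (hg a ha) (hh b hb)

theorem single_mul_mem_degLT (r : R) (hh : h ∈ degLT R q) :
    AddMonoidAlgebra.single p r * h ∈ degLT R (p + q) := by
  classical
  intro i hi
  obtain ⟨a, ha, b, hb, rfl⟩ := Finset.mem_add.1 (AddMonoidAlgebra.support_coeff_mul_subset _ h hi)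
  rw [Finset.mem_singleton.1 (Finsupp.support_single_subset ha)]
  exact add_lt_add_right (hh b hb) p

theorem pow_sub_single_mem_degLT {r : R} (hg : g - AddMonoidAlgebra.single p r ∈ degLT R p)
    (n : ℕ) : g ^ n - AddMonoidAlgebra.single (n * p) (r ^ n) ∈ degLT R (n * p) := by
  induction n with
  | zero => simp [AddMonoidAlgebra.one_def, zero_mem]
  | succ n ih =>
    have h1 := single_mul_mem_degLT (p := n * p) (r ^ n) hg
    have h2 := single_mul_mem_degLT (p := p) r ih
    have h3 := mul_mem_degLT ih hg
    have e : ((n + 1 : ℕ) : ℚ) * p = n * p + p := by push_cast; ring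
    have e' : AddMonoidAlgebra.single (n * p + p) (r ^ (n + 1)) =
        AddMonoidAlgebra.single (n * p) (r ^ n) * AddMonoidAlgebra.single p r := by
      rw [AddMonoidAlgebra.single_mul_single, pow_succ]
    rw [e, e']
    rw [add_comm p] at h2
    -- With `a`, `b` the leading terms of `g ^ n`, `g`: `g ^ (n+1) - a b = a (g - b) + b (g ^ n - a)
    -- + (g ^ n - a)(g - b)`.
    have := add_mem (add_mem h1 h2) h3
    convert this using 1
    ring

end Degree

/-- `HasDegX` holds for the exponent of the leading term. -/
theorem hasDegX_of_sub_single_mem_degLT {g : AddMonoidAlgebra (Polynomial ℂ) ℚ} {p : ℚ}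
    {c : Polynomial ℂ} (hc : c ≠ 0)
    (hg : g - AddMonoidAlgebra.single p c ∈ degLT (Polynomial ℂ) p) : HasDegX g p := by
  classical
  constructor
  · rw [Finset.mem_coe, Finsupp.mem_support_iff]
    intro h
    have h1 : (g - AddMonoidAlgebra.single p c).coeff p ≠ 0 := by
      rw [AddMonoidAlgebra.coeff_sub, Finsupp.sub_apply, h]
      simpa [AddMonoidAlgebra.coeff_single] using hc
    exact lt_irrefl p (hg p (Finsupp.mem_support_iff.2 h1))
  · intro q hq
    by_contra! hlt
    have h1 : (g - AddMonoidAlgebra.single p c).coeff q ≠ 0 := by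
      rw [AddMonoidAlgebra.coeff_sub, Finsupp.sub_apply]
      simpa [AddMonoidAlgebra.coeff_single, Finsupp.single_apply, hlt.ne] using hq
    exact lt_asymm hlt (hg q (Finsupp.mem_support_iff.2 h1))

namespace GenericSeries

variable (ψ : GenericSeries)

theorem subst_X_zero : ψ.subst (X 0) = AddMonoidAlgebra.single 1 1 := by
  rw [subst, MvPolynomial.aeval_X]
  rfl

theorem subst_X_one : ψ.subst (X 1) = ψ.expr := by
  rw [subst, MvPolynomial.aeval_X]
  rfl

theorem subst_C (c : ℂ) : ψ.subst (C c) = AddMonoidAlgebra.single 0 (Polynomial.C c) := by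
  rw [subst, MvPolynomial.aeval_C]
  rfl

theorem expr_of_phi_eq_zero (h : ψ.phi = 0) :
    ψ.expr = AddMonoidAlgebra.single ψ.r Polynomial.X := by
  rw [expr, h, map_zero, zero_add]

/-- The term `ξ x ^ r` lies below every exponent of `φ`, so it cannot affect the leading term. -/
theorem expr_sub_single_mem_degLT {ω : ℚ} (hω : IsGreatest (ψ.phi.coeff.support : Set ℚ) ω) :
    ψ.expr - AddMonoidAlgebra.single ω (Polynomial.C (ψ.phi.coeff ω)) ∈
      degLT (Polynomial ℂ) ω := by
  classical
  rw [expr, add_sub_right_comm]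
  refine add_mem ?_ (single_mem_degLT (ψ.r_lt ω hω.1) _)
  intro q hq
  rw [Finsupp.mem_support_iff, AddMonoidAlgebra.coeff_sub, Finsupp.sub_apply,
    AddMonoidAlgebra.coeff_mapRingHom, AddMonoidAlgebra.coeff_single, Finsupp.single_apply] at hq
  split_ifs at hq with h
  · subst h
    simp at hq
  · refine lt_of_le_of_ne (hω.2 ?_) (Ne.symm h)
    rw [Finset.mem_coe, Finsupp.mem_support_iff]
    rintro h0
    simp [h0] at hq

end GenericSeries

namespace IsGenericSeriesOf

variable {ψ : GenericSeries} {ν : DiscVal} {m : ℤ}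

theorem exists_hasDegX (hψ : IsGenericSeriesOf ψ ν) (hm : ν xK = (m : WithTop ℤ)) {f : Poly2}
    (hf : f ≠ 0) : ∃ (k : ℤ) (d : ℚ), ν (toRat f) = (k : WithTop ℤ) ∧ HasDegX (ψ.subst f) d ∧
      (k : ℚ) = m * d := by
  obtain ⟨m', hm', h⟩ := hψ
  have : m' = m := by exact_mod_cast hm'.symm.trans hm
  exact this ▸ h f hf

theorem eq_mul_of_hasDegX (hψ : IsGenericSeriesOf ψ ν) (hm : ν xK = (m : WithTop ℤ)) {f : Poly2}
    (hf : f ≠ 0) {k : ℤ} (hk : ν (toRat f) = (k : WithTop ℤ)) {d : ℚ} (hd : HasDegX (ψ.subst f) d) :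
    (k : ℚ) = m * d := by
  obtain ⟨k', d', hk', hd', h⟩ := hψ.exists_hasDegX hm hf
  have : k' = k := by exact_mod_cast hk'.symm.trans hk
  rw [← this, h, hd.unique hd']

/-- A polynomial of degree less than `p` has value larger than `p * ν x` if `ν x < 0`. -/
theorem lt_of_mem_degLT (hψ : IsGenericSeriesOf ψ ν) (hm : ν xK = (m : WithTop ℤ)) (hm0 : m < 0)
    {f : Poly2} (hf : f ≠ 0) {p : ℚ} (hp : ψ.subst f ∈ degLT (Polynomial ℂ) p) :
    ∃ k : ℤ, ν (toRat f) = (k : WithTop ℤ) ∧ (m : ℚ) * p < k := by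
  obtain ⟨k, d, hk, hd, h⟩ := hψ.exists_hasDegX hm hf
  refine ⟨k, hk, ?_⟩
  rw [h]
  exact mul_lt_mul_of_neg_left (hp d hd.1) (by exact_mod_cast hm0)

/-- If a generic series of `ν` is not in normal form, then either `y - a` has positive value for some
`a`, or `x - b y ^ n` has larger value than `x` for some `b` and `n`. -/
theorem isNormal_or (hψ : IsGenericSeriesOf ψ ν) {k : ℤ} (hm : ν xK = (m : WithTop ℤ))
    (hk : ν yK = (k : WithTop ℤ)) (hm0 : m < 0) (hmk : m ≤ k) :
    ψ.IsNormal ∨ (k = 0 ∧ ∃ a : ℂ, 0 < ν (toRat (X 1 + C a))) ∨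
      ∃ (b : ℂ) (n : ℕ), (m : WithTop ℤ) < ν (toRat (X 0 + C b * X 1 ^ n)) := by
  have hmq : (m : ℚ) < 0 := by exact_mod_cast hm0
  have hmkq : (m : ℚ) ≤ k := by exact_mod_cast hmk
  -- Dividing `m ≤ m d` by the negative number `m` reverses the inequality.
  have hdegle : ∀ d : ℚ, (k : ℚ) = m * d → d ≤ 1 := by
    intro d hd
    by_contra! h
    nlinarith
  have hy0 : (X 1 : Poly2) ≠ 0 := MvPolynomial.X_ne_zero 1
  by_cases hφ : ψ.phi = 0
  · refine Or.inl (Or.inl ⟨hφ, hdegle _ (hψ.eq_mul_of_hasDegX hm hy0 hk ?_)⟩)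
    rw [ψ.subst_X_one, ψ.expr_of_phi_eq_zero hφ]
    refine hasDegX_of_sub_single_mem_degLT Polynomial.X_ne_zero ?_
    rw [sub_self]
    exact zero_mem _
  have hne : ψ.phi.coeff.support.Nonempty := by
    rw [Finsupp.support_nonempty_iff]
    contrapose! hφ
    exact AddMonoidAlgebra.coeff_injective hφ
  obtain ⟨ω, hω⟩ : ∃ ω, IsGreatest (ψ.phi.coeff.support : Set ℚ) ω :=
    ⟨_, Finset.isGreatest_max' _ hne⟩
  set a := ψ.phi.coeff ω with ha
  have ha0 : a ≠ 0 := Finsupp.mem_support_iff.1 hω.1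
  have hlead := ψ.expr_sub_single_mem_degLT hω
  have hkω : (k : ℚ) = m * ω := by
    refine hψ.eq_mul_of_hasDegX hm hy0 hk ?_
    rw [ψ.subst_X_one]
    exact hasDegX_of_sub_single_mem_degLT (Polynomial.C_ne_zero.2 ha0) hlead
  have hω1 := hdegle ω hkω
  by_cases hω0 : ω = 0
  · right; left
    have hk0 : k = 0 := by
      rw [hω0, mul_zero] at hkω
      exact_mod_cast hkω
    refine ⟨hk0, -a, ?_⟩
    obtain ⟨l, hl, hlt⟩ := hψ.lt_of_mem_degLT hm hm0 (f := X 1 + C (-a)) (p := 0)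
      (by
        intro h
        have := congrArg (MvPolynomial.eval ![0, a + 1]) h
        simp at this)
      (by
        rw [GenericSeries.subst, map_add]
        change ψ.subst _ + ψ.subst _ ∈ _
        rw [ψ.subst_X_one, ψ.subst_C, Polynomial.C_neg, AddMonoidAlgebra.single_neg,
          ← sub_eq_add_neg]
        rw [← ha] at hlead
        rwa [← hω0])
    rw [hl]
    rw [mul_zero] at hlt
    have : 0 < l := by exact_mod_cast hlt
    exact_mod_cast this
  by_cases hωn : ∃ n : ℕ, 1 ≤ n ∧ ω = 1 / (n : ℚ)
  · right; right
    obtain ⟨n, hn, hωn⟩ := hωn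
    have hn0 : (n : ℚ) ≠ 0 := by positivity
    have hnω : (n : ℚ) * ω = 1 := by rw [hωn]; field_simp
    -- As `n ω = 1`, the leading term of `y ^ n` is `a ^ n x`; this coefficient makes it cancel `x`.
    refine ⟨-(a ^ n)⁻¹, n, ?_⟩
    obtain ⟨l, hl, hlt⟩ := hψ.lt_of_mem_degLT hm hm0 (f := X 0 + C (-(a ^ n)⁻¹) * X 1 ^ n) (p := 1)
      (by
        intro h
        have := congrArg (MvPolynomial.eval ![1, 0]) h
        simp [show n ≠ 0 by omega] at this)
      (by
        have h1 := pow_sub_single_mem_degLT hlead n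
        rw [hnω] at h1
        have h2 := single_mul_mem_degLT (p := 0) (Polynomial.C (-(a ^ n)⁻¹)) h1
        rw [zero_add, mul_sub, AddMonoidAlgebra.single_mul_single, zero_add, ← Polynomial.C_pow,
          ← Polynomial.C_mul, neg_mul, inv_mul_cancel₀ (pow_ne_zero n ha0), map_neg _ (1 : ℂ),
          Polynomial.C_1, AddMonoidAlgebra.single_neg (m := 1), sub_neg_eq_add] at h2
        rw [GenericSeries.subst, map_add, map_mul, map_pow]
        change ψ.subst _ + ψ.subst _ * (ψ.subst _) ^ n ∈ _
        rw [ψ.subst_X_one, ψ.subst_C, ψ.subst_X_zero, add_comm]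
        exact h2)
    rw [hl]
    rw [mul_one] at hlt
    have : m < l := by exact_mod_cast hlt
    exact_mod_cast this
  · left; right
    push Not at hωn
    have hω1' : ω ≠ 1 := by simpa using hωn 1 le_rfl
    refine ⟨ω, hω, lt_of_le_of_ne hω1 hω1', fun n hn => ?_, hωn⟩
    rcases n with _ | _ | n
    · exact hω0 (by simpa using hn)
    · exact hω1' (by simpa using hn)
    · rw [hn] at hω1
      push_cast at hω1
      have : (0 : ℚ) ≤ n := Nat.cast_nonneg n
      linarith

end IsGenericSeriesOf

end DegPuiseux

end

/-! ### Minimizing over compositions of elementary automorphisms -/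

noncomputable section

namespace DegPuiseux

open MvPolynomial (X C)

/-- The complexity of a valuation in the coordinates `(f, g)`: it decreases when the value of `f` or
`g` increases, as long as this value is not positive. -/
def complexity (ν : DiscVal) (f g : Poly2) : ℕ :=
  (1 - (ν (toRat f)).untopD 0).toNat + (1 - (ν (toRat g)).untopD 0).toNat

theorem complexity_comm (ν : DiscVal) (f g : Poly2) : complexity ν f g = complexity ν g f :=
  add_comm _ _

/-- A value `k ≤ 0` contributes `1 - k ≥ 1`, so even a rise from `0` to a positive value is counted.
Nonvanishing of `h` keeps its value finite, away from the default `0` of `untopD`. -/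
theorem complexity_lt_complexity {ν : DiscVal} {f g h : Poly2} {k : ℤ}
    (hg : ν (toRat g) = (k : WithTop ℤ)) (hk : k ≤ 0) (hh : h ≠ 0)
    (hlt : (k : WithTop ℤ) < ν (toRat h)) : complexity ν f h < complexity ν f g := by
  have hh0 : toRat h ≠ 0 := by
    rwa [toRat, Ne, map_eq_zero_iff _ (IsFractionRing.injective Poly2 RatFun2)]
  obtain ⟨l, hl⟩ := exists_coe_eq_of_ne_zero ν hh0
  rw [hl] at hlt
  have hkl : k < l := by exact_mod_cast hlt
  rw [complexity, complexity, hg, hl, WithTop.untopD_coe, WithTop.untopD_coe]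
  omega

/-- The finite sequences of automorphisms `(x, y) ↦ (y, x)` and `(x, y) ↦ (x, y + g(x))`. -/
def IsElementaryList (l : List (Poly2 ≃ₐ[ℂ] Poly2)) : Prop :=
  ∀ F ∈ l, IsTypeI F ∨ IsTypeII F

theorem IsElementaryList.append_swap {l : List (Poly2 ≃ₐ[ℂ] Poly2)} (hl : IsElementaryList l) :
    IsElementaryList (l ++ [swapAut]) := by
  intro F hF
  rcases List.mem_append.1 hF with h | h
  · exact hl F h
  · rw [List.mem_singleton.1 h]
    exact Or.inl isTypeI_swapAut

theorem IsElementaryList.append_shear {l : List (Poly2 ≃ₐ[ℂ] Poly2)} (hl : IsElementaryList l)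
    (g : Polynomial ℂ) : IsElementaryList (l ++ [shearAut g]) := by
  intro F hF
  rcases List.mem_append.1 hF with h | h
  · exact hl F h
  · rw [List.mem_singleton.1 h]
    exact Or.inr (isTypeII_shearAut g)

/-- There is a composition of elementary automorphisms which minimizes the complexity of `ν`. -/
theorem exists_minimal_complexity (ν : DiscVal) :
    ∃ l : List (Poly2 ≃ₐ[ℂ] Poly2), IsElementaryList l ∧
      ν (toRat (l.prod (X 0))) ≤ ν (toRat (l.prod (X 1))) ∧
      ∀ l' : List (Poly2 ≃ₐ[ℂ] Poly2), IsElementaryList l' →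
        complexity ν (l.prod (X 0)) (l.prod (X 1)) ≤
          complexity ν (l'.prod (X 0)) (l'.prod (X 1)) := by
  classical
  let P : ℕ → Prop := fun n => ∃ l : List (Poly2 ≃ₐ[ℂ] Poly2), IsElementaryList l ∧
    complexity ν (l.prod (X 0)) (l.prod (X 1)) = n
  have hP : ∃ n, P n := ⟨_, [], by intro F hF; simp at hF, rfl⟩
  obtain ⟨l, hl, hln⟩ := Nat.find_spec hP
  have hmin : ∀ l' : List (Poly2 ≃ₐ[ℂ] Poly2), IsElementaryList l' →
      complexity ν (l.prod (X 0)) (l.prod (X 1)) ≤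
        complexity ν (l'.prod (X 0)) (l'.prod (X 1)) := by
    intro l' hl'
    rw [hln]
    exact Nat.find_min' hP ⟨l', hl', rfl⟩
  -- The complexity is symmetric, so a final swap arranges the order of the values without losing
  -- minimality.
  rcases le_total (ν (toRat (l.prod (X 0)))) (ν (toRat (l.prod (X 1)))) with h | h
  · exact ⟨l, hl, h, hmin⟩
  · have h0 : (l ++ [swapAut]).prod (X 0) = l.prod (X 1) := by
      rw [List.prod_append, List.prod_singleton, AlgEquiv.mul_apply, swapAut_X_zero]
    have h1 : (l ++ [swapAut]).prod (X 1) = l.prod (X 0) := by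
      rw [List.prod_append, List.prod_singleton, AlgEquiv.mul_apply, swapAut_X_one]
    refine ⟨l ++ [swapAut], hl.append_swap, by rwa [h0, h1], fun l' hl' => ?_⟩
    rw [h0, h1, complexity_comm]
    exact hmin l' hl'

end DegPuiseux

end

/-! ### Minimal complexity forces the normal form -/

open DegPuiseux MvPolynomial in
theorem lemma3p1 (ν : DegPuiseux.DiscVal) (hdiv : DegPuiseux.IsDivisorial ν)
    (hinf : DegPuiseux.IsCenteredAtInfinity ν) :
    ∃ l : List (DegPuiseux.Poly2 ≃ₐ[ℂ] DegPuiseux.Poly2),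
      (∀ F ∈ l, DegPuiseux.IsTypeI F ∨ DegPuiseux.IsTypeII F) ∧
      (∃ ψ : DegPuiseux.GenericSeries,
        DegPuiseux.IsGenericSeriesOf ψ (DegPuiseux.inCoordinates ν l.prod)) ∧
      ∀ ψ : DegPuiseux.GenericSeries,
        DegPuiseux.IsGenericSeriesOf ψ (DegPuiseux.inCoordinates ν l.prod) → ψ.IsNormal := by
  obtain ⟨hc, z, hz⟩ := hdiv.residue
  obtain ⟨l, hl, hxy, hmin⟩ := exists_minimal_complexity ν
  set F := l.prod
  have hX0 : F (X 0) ≠ 0 := by simp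
  have hX1 : F (X 1) ≠ 0 := by simp
  have hinj : ∀ f : Poly2, f ≠ 0 → toRat f ≠ 0 := by
    intro f hf
    rwa [toRat, Ne, map_eq_zero_iff _ (IsFractionRing.injective Poly2 RatFun2)]
  have hx : inCoordinates ν F xK = ν (toRat (F (X 0))) := inCoordinates_toRat ν F (X 0)
  have hy : inCoordinates ν F yK = ν (toRat (F (X 1))) := inCoordinates_toRat ν F (X 1)
  have hc' : ∀ c : ℂ, c ≠ 0 → inCoordinates ν F (algebraMap ℂ RatFun2 c) = 0 := by
    intro c h
    rw [inCoordinates_algebraMap, hc c h]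
  have hxlt : inCoordinates ν F xK < 0 :=
    (inCoordinates_centered ν F hinf).lt_zero hc' (by rwa [hx, hy])
  obtain ⟨z', hz'⟩ := inCoordinates_residue ν F hz
  refine ⟨l, hl, exists_isGenericSeriesOf _ hc' hz' hxlt, fun ψ hψ => ?_⟩
  obtain ⟨m, hm⟩ := exists_coe_eq_of_ne_zero ν (hinj _ hX0)
  obtain ⟨k, hk⟩ := exists_coe_eq_of_ne_zero ν (hinj _ hX1)
  have hm0 : m < 0 := by
    rw [hx, hm] at hxlt
    exact_mod_cast hxlt
  have hmk : m ≤ k := by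
    rw [hm, hk] at hxy
    exact_mod_cast hxy
  rcases hψ.isNormal_or (hx.trans hm) (hy.trans hk) hm0 hmk with h | ⟨hk0, a, ha⟩ | ⟨b, n, hb⟩
  · exact h
  · exfalso
    -- The last automorphism of a list acts first, so appending a shear replaces `F y` by `F (y +
    -- a)`.
    have h0 : (l ++ [shearAut (Polynomial.C a)]).prod (X 0) = F (X 0) := by
      rw [List.prod_append, List.prod_singleton, AlgEquiv.mul_apply, shearAut_X_zero]
    have h1 : (l ++ [shearAut (Polynomial.C a)]).prod (X 1) = F (X 1 + C a) := by
      rw [List.prod_append, List.prod_singleton, AlgEquiv.mul_apply, shearAut_X_one,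
        Polynomial.aeval_C]
      rfl
    refine absurd (hmin _ (hl.append_shear (Polynomial.C a))) (not_le.2 ?_)
    rw [h0, h1]
    rw [inCoordinates_toRat] at ha
    refine complexity_lt_complexity hk hk0.le ?_ (by rwa [hk0])
    rw [← h1]
    simp
  · exfalso
    -- A shear alters only the second coordinate, so a swap first brings `x` there; the new pair is
    -- `F y`, `F (x + b y ^ n)`.
    set g : Polynomial ℂ := Polynomial.C b * Polynomial.X ^ n
    have h0 : ((l ++ [swapAut]) ++ [shearAut g]).prod (X 0) = F (X 1) := by
      rw [List.prod_append, List.prod_append, List.prod_singleton, List.prod_singleton,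
        AlgEquiv.mul_apply, AlgEquiv.mul_apply, shearAut_X_zero, swapAut_X_zero]
    have h1 : ((l ++ [swapAut]) ++ [shearAut g]).prod (X 1) = F (X 0 + C b * X 1 ^ n) := by
      rw [List.prod_append, List.prod_append, List.prod_singleton, List.prod_singleton,
        AlgEquiv.mul_apply, AlgEquiv.mul_apply, shearAut_X_one, map_add, swapAut_X_one,
        ← Polynomial.aeval_algHom_apply swapAut, swapAut_X_zero]
      simp [g, F, MvPolynomial.algebraMap_eq]
    refine absurd (hmin _ (hl.append_swap.append_shear g)) (not_le.2 ?_)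
    rw [h0, h1, complexity_comm ν (F (X 0))]
    rw [inCoordinates_toRat] at hb
    refine complexity_lt_complexity hm hm0.le ?_ hb
    rw [← h1]
    simp
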